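/- Let $K$ be a field of characteristic $2$, let $\Lambda=\Lambda(x_i\mid i\ge 0)$ be the Grassmann algebra over $K$ in the letters $x_0,x_1,x_2,\dots$, let $\partial_i$ be the superderivation of $\Lambda$ with $\partial_i(x_j)=\delta_{ij}$, and identify $x_i$ with the operator of left multiplication by $x_i$ on $\Lambda$. For $i\ge 0$ let $$v_i=\partial_i+x_ix_{i+1}\bigl(\partial_{i+2}+x_{i+2}x_{i+3}(\partial_{i+4}+x_{i+4}x_{i+5}(\partial_{i+6}+\cdots))\bigr),$$ an operator on $\Lambda$ (on each element of $\Lambda$ only finitely many terms are nonzero). Let $\mathbf R$ be the Lie subalgebra of $\operatorname{End}_K\Lambda$, with bracket $[a,b]=ab-ba$, generated by $v_0$ and $v_1$ (using the bracket only, without squares or a $p$-mapping). For $n\ge 1$ let $\mathbf R_n$ be the span of all Lie monomials of degree $n$ in $v_0,v_1$. Let $\mathbf R^1=\mathbf R$, $\mathbf R^{n+1}=[\mathbf R,\mathbf R^n]$ be the lower central series, and put $a_n=\dim\mathbf R_n$. Then: 1. $\mathbf R=\bigoplus_{n\ge1}\mathbf R_n$ is an $\mathbb N$-graded Lie algebra,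 and $a_n=\dim \mathbf R^n/\mathbf R^{n+1}$ for all $n\ge1$. 2. The sequence $(a_n)$, starting with $n=5$, is a concatenation of infinitely many pieces, each of which is a block $1,1$ followed either by $2$ (a diamond) or by $2,2,2$ (a triplet of diamonds). 3. The sequence $(a_n)$ is not eventually periodic. 4. $\mathbf R$ is of width $2$, that is, $2$ is the least integer $d$ with $\dim\mathbf R_n\le d$ for all $n\ge 1$; but $\mathbf R$ is not thin. Here a graded Lie algebra $L=\bigoplus_{n\ge1}L_n$ is called thin if $\dim L_1=2$ and $L_{n+1}=[L_1,z]$ for all $n\ge1$ and all $0\ne z\in L_n$. -/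

import Mathlib

namespace FractalLie

section Grassmann

attribute [local instance 100] LieRing.ofAssociativeRing

variable (K : Type*) [Field K]

/-- The Grassmann algebra `Λ = Λ(x_i | i ≥ 0)` in countably many letters. -/
abbrev Grassmann : Type _ := ExteriorAlgebra K (ℕ →₀ K)

/-- The Grassmann letter `x_i`. -/
noncomputable def letter (i : ℕ) : Grassmann K :=
  ExteriorAlgebra.ι K (Finsupp.single i 1)

/-- The superderivative `∂_i` of `Λ` with `∂_i (x_j) = δ_{ij}`, namely the contraction with the
`i`-th coordinate functional: `∂_i (m * b) = m_i b - m * ∂_i b` for `m` in the span of the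
letters. -/
noncomputable def partialD (i : ℕ) : Module.End K (Grassmann K) :=
  CliffordAlgebra.contractLeft (Q := (0 : QuadraticForm K (ℕ →₀ K))) (Finsupp.lapply i)

/-- The `l`-th summand `x_i x_{i+1} x_{i+2} ⋯ x_{i+2l-1} ∂_{i+2l}` of the pivot element `v_i`,
letters acting on `Λ` by left multiplication. -/
noncomputable def pivotTerm : ℕ → ℕ → Module.End K (Grassmann K)
  | i, 0 => partialD K i
  | i, l + 1 =>
      LinearMap.mulLeft K (letter K i) * LinearMap.mulLeft K (letter K (i + 1)) *
        pivotTerm (i + 2) l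

theorem partialD_algebraMap (i : ℕ) (r : K) :
    partialD K i (algebraMap K (Grassmann K) r) = 0 :=
  CliffordAlgebra.contractLeft_algebraMap (0 : QuadraticForm K (ℕ →₀ K))
    (d := Finsupp.lapply i) r

theorem partialD_ι_mul (i : ℕ) (m : ℕ →₀ K) (f : Grassmann K) :
    partialD K i (ExteriorAlgebra.ι K m * f) =
      m i • f - ExteriorAlgebra.ι K m * partialD K i f :=
  CliffordAlgebra.contractLeft_ι_mul (Q := (0 : QuadraticForm K (ℕ →₀ K)))
    (d := Finsupp.lapply i) m f

theorem partialD_eventually_zero (f : Grassmann K) : ∃ N, ∀ j, N ≤ j → partialD K j f = 0 := by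
  refine CliffordAlgebra.left_induction (Q := (0 : QuadraticForm K (ℕ →₀ K)))
    (P := fun f => ∃ N, ∀ j, N ≤ j → partialD K j f = 0) ?_ ?_ ?_ f
  · exact fun r => ⟨0, fun j _ => partialD_algebraMap K j r⟩
  · rintro x y ⟨M, hM⟩ ⟨N, hN⟩
    refine ⟨max M N, fun j hj => ?_⟩
    rw [map_add, hM j (le_trans (le_max_left _ _) hj), hN j (le_trans (le_max_right _ _) hj),
      add_zero]
  · rintro x m ⟨M, hM⟩
    refine ⟨max M (m.support.sup id + 1), fun j hj => ?_⟩
    have h1 : M ≤ j := le_trans (le_max_left _ _) hj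
    have h2 : m.support.sup id + 1 ≤ j := le_trans (le_max_right _ _) hj
    have h3 : m j = 0 := by
      by_contra h
      have h4 : j ≤ m.support.sup id :=
        Finset.le_sup (f := id) (Finsupp.mem_support_iff.mpr h)
      omega
    refine (partialD_ι_mul K j m x).trans ?_
    rw [hM j h1, h3, zero_smul, mul_zero, sub_zero]

theorem pivotTerm_apply_eq_zero (f : Grassmann K) :
    ∀ l i : ℕ, partialD K (i + 2 * l) f = 0 → pivotTerm K i l f = 0
  | 0, i, h => h
  | l + 1, i, h => by
    have h1 : pivotTerm K (i + 2) l f = 0 :=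
      pivotTerm_apply_eq_zero f l (i + 2) (by
        have h2 : i + 2 + 2 * l = i + 2 * (l + 1) := by ring
        rwa [h2])
    simp [pivotTerm, h1]

theorem pivotTerm_finite_support (i : ℕ) (f : Grassmann K) :
    (Function.support fun l => pivotTerm K i l f).Finite := by
  obtain ⟨N, hN⟩ := partialD_eventually_zero K f
  refine (Set.finite_lt_nat N).subset fun l hl => ?_
  by_contra h
  have h1 : N ≤ l := not_lt.mp h
  exact hl (pivotTerm_apply_eq_zero K f l i (hN _ (by omega)))

/-- The pivot element
`v_i = ∂_i + x_i x_{i+1} (∂_{i+2} + x_{i+2} x_{i+3} (∂_{i+4} + ⋯ ))`, acting on `Λ`.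
On each element of `Λ` only finitely many summands are nonzero. -/
noncomputable def pivot (i : ℕ) : Module.End K (Grassmann K) where
  toFun f := ∑ᶠ l : ℕ, pivotTerm K i l f
  map_add' f g := by
    simp only [map_add]
    exact finsum_add_distrib (pivotTerm_finite_support K i f) (pivotTerm_finite_support K i g)
  map_smul' c f := by
    simp only [map_smul, RingHom.id_apply]
    exact (smul_finsum' c (pivotTerm_finite_support K i f)).symm

/-- The Lie algebra `R = Lie(v_0, v_1)` generated by `v_0` and `v_1` using the bracket only,
inside the linear operators on `Λ` with bracket `⁅a, b⁆ = a * b - b * a`.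
In characteristic two (the only case it is used in) this bracket is the supercommutator. -/
noncomputable def R : LieSubalgebra K (Module.End K (Grassmann K)) :=
  LieSubalgebra.lieSpan K (Module.End K (Grassmann K)) {pivot K 0, pivot K 1}

/-- The generating set `{v_0, v_1}` as a subset of `R`. -/
def gens : Set (R K) := {a | (a : Module.End K (Grassmann K)) ∈ ({pivot K 0, pivot K 1} : Set _)}

end Grassmann

section Graded

variable (K : Type*) {L : Type*} [Field K] [LieRing L] [LieAlgebra K L]

/-- `IsLieMonomial X n a`: the element `a` is a Lie monomial (an iterated bracket, with any
arrangement of brackets) of length `n` in the elements of `X`. -/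
inductive IsLieMonomial (X : Set L) : ℕ → L → Prop
  | of (a : L) (ha : a ∈ X) : IsLieMonomial X 1 a
  | lie (m n : ℕ) (a b : L) (ha : IsLieMonomial X m a) (hb : IsLieMonomial X n b) :
      IsLieMonomial X (m + n) ⁅a, b⁆

/-- The span of the Lie monomials of degree `n` in `X`. -/
def degreeComponent (X : Set L) (n : ℕ) : Submodule K L :=
  Submodule.span K {a | IsLieMonomial X n a}

variable {K}

/-- `L = ⨁_{n ≥ 1} L_n` is an `ℕ`-graded Lie algebra (with zero component in degree `0`). -/
structure IsLieGrading (𝓛 : ℕ → Submodule K L) : Prop where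
  zero_eq_bot : 𝓛 0 = ⊥
  isInternal : DirectSum.IsInternal 𝓛
  lie_mem : ∀ m n : ℕ, ∀ a ∈ 𝓛 m, ∀ b ∈ 𝓛 n, ⁅a, b⁆ ∈ 𝓛 (m + n)

/-- Width `d`: `dim L_n ≤ d` for all `n ≥ 1`, the integer `d` being minimal. -/
def HasWidth (𝓛 : ℕ → Submodule K L) (d : ℕ) : Prop :=
  IsLeast {e : ℕ | ∀ n : ℕ, 1 ≤ n → Module.rank K (𝓛 n) ≤ (e : Cardinal)} d

/-- A graded Lie algebra is thin if `dim L_1 = 2` and it has the covering property: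
`L_{n+1} = [L_1, z]` for all `0 ≠ z ∈ L_n` and all `n ≥ 1`. -/
structure IsThin (𝓛 : ℕ → Submodule K L) : Prop where
  isLieGrading : IsLieGrading 𝓛
  finrank_one : Module.finrank K (𝓛 1) = 2
  covering : ∀ n : ℕ, 1 ≤ n → ∀ z ∈ 𝓛 n, z ≠ 0 →
    (𝓛 (n + 1) : Set L) = {w | ∃ y ∈ 𝓛 1, ⁅y, z⁆ = w}

variable (K L)

/-- The `n`-th term of the lower central series, numbered by
`L^1 = L`, `L^{n+1} = [L, L^n]`; for `n = 0` also `L`. -/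
def lowerCentral (n : ℕ) : Submodule K L :=
  (LieModule.lowerCentralSeries K L L (n - 1)).toSubmodule

/-- The lower central series factor `L^n / L^{n+1}`. -/
abbrev LowerCentralFactor (n : ℕ) : Type _ :=
  lowerCentral K L n ⧸ (lowerCentral K L (n + 1)).submoduleOf (lowerCentral K L n)

end Graded

/-- The sequence `a`, starting with index `n₀`, is a concatenation of infinitely many pieces, each
of which is a block `1,1` followed either by `2` or by `2,2,2`; the `j`-th piece starts at index
`s j`, and `k j` is the number of its entries `2`. -/
def IsDiamondPattern (a : ℕ → ℕ) (n₀ : ℕ) : Prop :=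
  ∃ s k : ℕ → ℕ, s 0 = n₀ ∧ ∀ j : ℕ,
    (k j = 1 ∨ k j = 3) ∧ s (j + 1) = s j + 2 + k j ∧
    a (s j) = 1 ∧ a (s j + 1) = 1 ∧ ∀ i < k j, a (s j + 2 + i) = 2

/-- `a (n + p) = a n` for all large `n`, with some period `p ≥ 1`. -/
def EventuallyPeriodic (a : ℕ → ℕ) : Prop :=
  ∃ p N : ℕ, 1 ≤ p ∧ ∀ n, N ≤ n → a (n + p) = a n

/-- The degree component `R_n`, `n ≥ 1`, spanned by the Lie monomials of degree `n` in
`v_0, v_1`. -/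
noncomputable def RComponent (K : Type*) [Field K] (n : ℕ) : Submodule K (R K) :=
  degreeComponent K (gens K) n

end FractalLie

/-! In characteristic 2 signs disappear, letters and derivatives with distinct indices commute, and
v_i = ∂_i + x_i x_{i+1} v_{i+2} (`pivot_eq`). Hence [v_i, v_{i+1}] = x_i v_{i+2}, and a further
bracket with v_i strips off x_i. Consider v_0 together with all x^α v_n, n ≥ 1, α ⊆ {0, …, n-2}.
Bracketing with v_0 or v_1 sends each of these to another one or to zero (`lie_pivot_zero_basisElt`,
`lie_pivot_one_basisElt`) and raises by one the weight in which v_n counts 1, 1, 3, 5, 11, … and x_i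
counts minus the weight of v_i. The family is linearly independent, it spans R, and each member of
weight at least 2 is such a bracket. `IsStandardBasis` isolates these facts; they give the grading
and the lower central series, and they turn a_n into the number of basis elements of weight n.

For fixed n, the numbers of x^α v_n in successive weights form a word. One more available letter x_m
superposes two copies of the word, shifted by the weight of v_m; according to the parity of m the
copies abut or overlap in one place, where 1 + 1 makes a 2. These words, and their superposition
over all n, reproduce themselves under 1 ↦ 112, 2 ↦ 11222 (`cons_word`, `totalWord_add_two`). So the
terms a_5, a_6, … are the image of a_2, a_3, …, which is the diamond pattern. An eventual period p
would desubstitute to a period q with 3q ≤ p, so descent excludes periodicity. Thinness fails at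
v_2, of degree 3: [v_0, v_2] = 0 and [v_1, v_2] = x_1 v_3, while degree 4 also contains x_0 v_3. -/

namespace FractalLie

/-! ### Pivot elements as operators and their brackets with monomials -/

section Operators

variable (K : Type*) [Field K]

/-- Left multiplication by the letter `x_i`. -/
noncomputable abbrev mulLetter (i : ℕ) : Module.End K (Grassmann K) :=
  LinearMap.mulLeft K (letter K i)

theorem pivotTerm_commute_of_commute (T : Module.End K (Grassmann K)) (n : ℕ)
    (hD : ∀ j, n ≤ j → Commute T (partialD K j)) (hX : ∀ j, n ≤ j → Commute T (mulLetter K j)) :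
    ∀ l i, n ≤ i → Commute T (pivotTerm K i l)
  | 0, i, hi => hD i hi
  | l + 1, i, hi =>
      ((hX i hi).mul_right (hX (i + 1) (by omega))).mul_right
        (pivotTerm_commute_of_commute T n hD hX l (i + 2) (by omega))

theorem pivot_apply (i : ℕ) (f : Grassmann K) :
    pivot K i f = ∑ᶠ l : ℕ, pivotTerm K i l f := rfl

/-- Every summand of v_n is a product of operators ∂_j and x_j with j ≥ n, and on each vector the
sum is finite, so commutation can be checked termwise. -/
theorem pivot_commute_of_commute (T : Module.End K (Grassmann K)) (n : ℕ)
    (hD : ∀ j, n ≤ j → Commute T (partialD K j)) (hX : ∀ j, n ≤ j → Commute T (mulLetter K j)) :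
    Commute T (pivot K n) := by
  refine LinearMap.ext fun f => ?_
  rw [Module.End.mul_apply, Module.End.mul_apply, pivot_apply, pivot_apply]
  have h := T.toAddMonoidHom.map_finsum (pivotTerm_finite_support K n f)
  simp only [LinearMap.toAddMonoidHom_coe] at h
  rw [h]
  refine finsum_congr fun l => ?_
  exact LinearMap.congr_fun (pivotTerm_commute_of_commute K T n hD hX l n le_rfl) f

theorem pivot_eq (i : ℕ) :
    pivot K i = partialD K i + mulLetter K i * mulLetter K (i + 1) * pivot K (i + 2) := by
  refine LinearMap.ext fun f => ?_
  have hfin := pivotTerm_finite_support K i f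
  rw [LinearMap.add_apply, pivot_apply, Module.End.mul_apply, pivot_apply]
  have h := (mulLetter K i * mulLetter K (i + 1)).toAddMonoidHom.map_finsum
    (pivotTerm_finite_support K (i + 2) f)
  simp only [LinearMap.toAddMonoidHom_coe] at h
  rw [h]
  obtain ⟨N, hN⟩ := hfin.bddAbove
  have hz : ∀ l, N < l → pivotTerm K i l f = 0 := fun l hl => by
    by_contra h0
    exact absurd (hN h0) (by omega)
  -- The extra index on the left is l = 0, the summand ∂_i; the others are shifted by one.
  rw [finsum_eq_sum_of_support_subset (s := Finset.range (N + 2)),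
    finsum_eq_sum_of_support_subset (s := Finset.range (N + 1)), Finset.sum_range_succ', add_comm]
  · rfl
  · intro l hl
    by_contra h0
    exact hl (hz (l + 1) (by simp at h0; omega))
  · intro l hl
    by_contra h0
    exact hl (hz l (by simp at h0; omega))

theorem letter_mul_self (i : ℕ) : letter K i * letter K i = 0 :=
  ExteriorAlgebra.ι_sq_zero _

theorem mulLetter_mul_self (i : ℕ) : mulLetter K i * mulLetter K i = 0 := by
  refine LinearMap.ext fun f => ?_
  simp [← mul_assoc, letter_mul_self]

/-- The monomial in `x_i, x_{i+1}, …` with the given list of exponents. -/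
noncomputable def mon : ℕ → List Bool → Grassmann K
  | _, [] => 1
  | i, true :: l => letter K i * mon (i + 1) l
  | i, false :: l => mon (i + 1) l

/-- The operator `x^α v_n`, with `α` the list of exponents of `x_i, x_{i+1}, …, x_{n-2}`. -/
noncomputable def monPivot : ℕ → List Bool → Module.End K (Grassmann K)
  | i, [] => pivot K (i + 1)
  | i, true :: l => mulLetter K i * monPivot (i + 1) l
  | i, false :: l => monPivot (i + 1) l

theorem monPivot_apply : ∀ (i : ℕ) (l : List Bool) (f : Grassmann K),
    monPivot K i l f = mon K i l * pivot K (i + l.length + 1) f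
  | i, [], f => by simp [monPivot, mon]
  | i, true :: l, f => by
      have h : i + (true :: l).length + 1 = i + 1 + l.length + 1 := by simp; omega
      simp only [monPivot, mon, Module.End.mul_apply, monPivot_apply (i + 1) l f, h]
      simp [mul_assoc]
  | i, false :: l, f => by
      have h : i + (false :: l).length + 1 = i + 1 + l.length + 1 := by simp; omega
      rw [monPivot, mon, monPivot_apply (i + 1) l f, h]

theorem commute_monPivot (T : Module.End K (Grassmann K)) {n : ℕ}
    (hV : ∀ j, n ≤ j → Commute T (pivot K (j + 1)))
    (hX : ∀ j, n ≤ j → Commute T (mulLetter K j)) :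
    ∀ (l : List Bool) (i : ℕ), n ≤ i → Commute T (monPivot K i l)
  | [], i, hi => hV i hi
  | true :: l, i, hi => (hX i hi).mul_right (commute_monPivot T hV hX l (i + 1) (by omega))
  | false :: l, i, hi => commute_monPivot T hV hX l (i + 1) (by omega)

attribute [local instance 100] LieRing.ofAssociativeRing

/-- Only the tail x_i x_{i+1} v_{i+2} of v_i acts on such a Y, and x_i moves out in front. -/
theorem lie_pivot_of_commute (i : ℕ) (Y : Module.End K (Grassmann K))
    (hD : Commute (partialD K i) Y) (hX : Commute (mulLetter K i) Y) :
    ⁅pivot K i, Y⁆ = mulLetter K i * ⁅mulLetter K (i + 1) * pivot K (i + 2), Y⁆ := by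
  rw [pivot_eq, Ring.lie_def, Ring.lie_def, add_mul, mul_add, hD.eq, mul_sub]
  simp only [mul_assoc]
  rw [← mul_assoc Y (mulLetter K i), ← hX.eq]
  simp only [mul_assoc]
  abel

/-- The basis of `R`: the element `v_0` and the elements `x^α v_n` for `n ≥ 1` and
`α ⊆ {0, …, n - 2}`. -/
noncomputable def basisElt : Option (List Bool) → Module.End K (Grassmann K)
  | none => pivot K 0
  | some l => monPivot K 0 l

/-- The index of the pivot element occurring in a basis element. -/
def pivotIndex : Option (List Bool) → ℕ
  | none => 0
  | some l => l.length + 1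

/-- The exponents of the letters occurring in a basis element. -/
def exponents : Option (List Bool) → List Bool
  | none => []
  | some l => l

theorem basisElt_apply (i : Option (List Bool)) (f : Grassmann K) :
    basisElt K i f = mon K 0 (exponents i) * pivot K (pivotIndex i) f := by
  cases i with
  | none => simp [basisElt, exponents, pivotIndex, mon]
  | some l => simp [basisElt, exponents, pivotIndex, monPivot_apply]

variable [CharP K 2]

theorem grassmann_add_self (f : Grassmann K) : f + f = 0 := by
  rw [← two_smul K f, CharTwo.two_eq_zero, zero_smul]

theorem end_add_self (f : Module.End K (Grassmann K)) : f + f = 0 := by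
  rw [← two_smul K f, CharTwo.two_eq_zero, zero_smul]

theorem grassmann_neg (f : Grassmann K) : -f = f :=
  neg_eq_of_add_eq_zero_left (grassmann_add_self K f)

theorem end_neg (f : Module.End K (Grassmann K)) : -f = f :=
  neg_eq_of_add_eq_zero_left (end_add_self K f)

theorem mulLetter_commute (i j : ℕ) : Commute (mulLetter K i) (mulLetter K j) := by
  refine LinearMap.ext fun f => ?_
  have h : letter K i * letter K j + letter K j * letter K i = 0 :=
    ExteriorAlgebra.ι_add_mul_swap _ _
  have h' := eq_neg_of_add_eq_zero_left h
  rw [grassmann_neg] at h'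
  simp [← mul_assoc, h']

theorem partialD_commute (i j : ℕ) : Commute (partialD K i) (partialD K j) := by
  refine LinearMap.ext fun f => ?_
  exact (CliffordAlgebra.contractLeft_comm (Q := (0 : QuadraticForm K (ℕ →₀ K))) _ _ f).trans
    (grassmann_neg K _)

theorem partialD_letter_mul (i j : ℕ) (f : Grassmann K) :
    partialD K i (letter K j * f) = (if j = i then f else 0) + letter K j * partialD K i f := by
  refine (partialD_ι_mul K i _ f).trans ?_
  rw [sub_eq_add_neg, grassmann_neg, Finsupp.single_apply]
  split_ifs <;> simp [letter]

theorem partialD_mulLetter_commute {i j : ℕ} (h : j ≠ i) :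
    Commute (partialD K i) (mulLetter K j) := by
  refine LinearMap.ext fun f => ?_
  simp [partialD_letter_mul, h]

theorem partialD_mul_mulLetter (i : ℕ) :
    partialD K i * mulLetter K i = 1 + mulLetter K i * partialD K i := by
  refine LinearMap.ext fun f => ?_
  simp [partialD_letter_mul]

theorem mulLetter_commute_pivot {j n : ℕ} (h : j < n) : Commute (mulLetter K j) (pivot K n) :=
  pivot_commute_of_commute K _ n
    (fun i hi => (partialD_mulLetter_commute K (by omega)).symm) fun i _ => mulLetter_commute K j i

theorem partialD_commute_pivot {j n : ℕ} (h : j < n) : Commute (partialD K j) (pivot K n) :=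
  pivot_commute_of_commute K _ n
    (fun i _ => partialD_commute K j i) fun i hi => partialD_mulLetter_commute K (by omega)

theorem pivot_letter_of_lt {j n : ℕ} (h : j < n) : pivot K n (letter K j) = 0 := by
  rw [pivot_apply]
  refine finsum_eq_zero_of_forall_eq_zero fun l => pivotTerm_apply_eq_zero K _ l n ?_
  have := partialD_letter_mul K (n + 2 * l) j 1
  rw [mul_one, if_neg (by omega), zero_add] at this
  rw [this, ← map_one (algebraMap K _), partialD_algebraMap, mul_zero]

theorem pivot_letter_self (n : ℕ) : pivot K n (letter K n) = 1 := by
  have := partialD_letter_mul K n n 1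
  rw [mul_one, if_pos rfl, ← map_one (algebraMap K _), partialD_algebraMap, mul_zero, add_zero,
    map_one] at this
  rw [pivot_eq, LinearMap.add_apply, this, Module.End.mul_apply,
    pivot_letter_of_lt K (by omega), map_zero, add_zero]

theorem mulLetter_commute_monPivot {j i : ℕ} (l : List Bool) (h : j ≤ i) :
    Commute (mulLetter K j) (monPivot K i l) :=
  commute_monPivot K _ (fun k hk => mulLetter_commute_pivot K (n := k + 1) (by omega))
    (fun k _ => mulLetter_commute K j k) l i h

theorem partialD_commute_monPivot {j i : ℕ} (l : List Bool) (h : j < i) :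
    Commute (partialD K j) (monPivot K i l) :=
  commute_monPivot K _ (n := i) (fun k hk => partialD_commute_pivot K (by omega))
    (fun k hk => partialD_mulLetter_commute K (by omega)) l i le_rfl

/-- The bracket with `v_i` on the exponents of `x_i, x_{i+1}, …`; `none` stands for zero. -/
def act : List Bool → Option (List Bool)
  | [] => some [true]
  | true :: l => some (false :: l)
  | [false] => none
  | false :: true :: _ => none
  | false :: false :: l => (act l).map fun l' => true :: true :: l'

/-- The tail of v_i contains x_i, so it dies against x_i Y by x_i² = 0; what remains is ∂_i, with
∂_i x_i = 1 + x_i ∂_i. -/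
theorem lie_pivot_mulLetter_mul (i : ℕ) (Y : Module.End K (Grassmann K))
    (hD : Commute (partialD K i) Y) (hX : Commute (mulLetter K i) Y) :
    ⁅pivot K i, mulLetter K i * Y⁆ = Y := by
  have h1 : pivot K i * mulLetter K i = 1 + mulLetter K i * partialD K i := by
    rw [pivot_eq, add_mul, partialD_mul_mulLetter, mul_assoc, ← (mulLetter_commute_pivot K
      (show i < i + 2 by omega)).eq, ← mul_assoc, mul_assoc (mulLetter K i) (mulLetter K (i + 1)),
      (mulLetter_commute K (i + 1) i).eq, ← mul_assoc (mulLetter K i), mulLetter_mul_self]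
    simp
  have h2 : mulLetter K i * pivot K i = mulLetter K i * partialD K i := by
    rw [pivot_eq, mul_add, ← mul_assoc, ← mul_assoc, mulLetter_mul_self]
    simp
  rw [Ring.lie_def, ← mul_assoc, h1, hX.eq, mul_assoc, h2, ← mul_assoc, ← hX.eq, mul_assoc,
    ← hD.eq, add_mul, one_mul, mul_assoc, add_sub_cancel_right]

theorem lie_pivot_pivot_succ (i : ℕ) :
    ⁅pivot K i, pivot K (i + 1)⁆ = mulLetter K i * pivot K (i + 2) := by
  rw [lie_pivot_of_commute K i _ (partialD_commute_pivot K (by omega))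
    (mulLetter_commute_pivot K (by omega)), ← lie_skew, end_neg, lie_pivot_mulLetter_mul K (i + 1)]
  · exact partialD_commute_pivot K (by omega)
  · exact mulLetter_commute_pivot K (by omega)

/-- A present x_i is differentiated away. If x_i is absent, only the tail of v_i acts: on v_{i+1}
its x_{i+1} is stripped and x_i v_{i+2} remains; v_{i+2} commutes with x_{i+1} v_{i+2}; a present
x_{i+1} is squared to zero; an absent one leaves x_i x_{i+1} times a bracket with v_{i+2}, which is
the recursion. -/
theorem lie_pivot_monPivot : ∀ (l : List Bool) (i : ℕ),
    ⁅pivot K i, monPivot K i l⁆ = (act l).elim 0 (monPivot K i)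
  | [], i => lie_pivot_pivot_succ K i
  | true :: l, i => lie_pivot_mulLetter_mul K i _ (partialD_commute_monPivot K l (by omega))
      (mulLetter_commute_monPivot K l (by omega))
  | [false], i => by
      simp only [monPivot, act, Option.elim]
      rw [lie_pivot_of_commute K i _ (partialD_commute_pivot K (by omega))
        (mulLetter_commute_pivot K (by omega)), Ring.lie_def, ← mul_assoc,
        (mulLetter_commute_pivot K (show i + 1 < i + 2 by omega)).eq]
      simp
  | false :: true :: l, i => by
      simp only [monPivot, act, Option.elim]
      have hc := mulLetter_commute_monPivot K l (show i + 1 ≤ i + 1 + 1 by omega)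
      have hv := mulLetter_commute_pivot K (show i + 1 < i + 2 by omega)
      have h0 := mulLetter_mul_self K (i + 1)
      rw [lie_pivot_of_commute K i, Ring.lie_def]
      · rw [hv.eq, mul_assoc, ← mul_assoc (mulLetter K (i + 1)), h0, hc.eq, mul_assoc,
          ← hv.eq, ← mul_assoc (mulLetter K (i + 1)), h0]
        simp
      · exact partialD_commute_monPivot K (true :: l) (by omega)
      · exact mulLetter_commute_monPivot K (true :: l) (by omega)
  | false :: false :: l, i => by
      have hc := mulLetter_commute_monPivot K l (show i + 1 ≤ i + 2 by omega)
      have h := lie_pivot_monPivot l (i + 2)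
      rw [Ring.lie_def] at h
      change ⁅pivot K i, monPivot K (i + 2) l⁆ = _
      rw [lie_pivot_of_commute K i, Ring.lie_def, ← mul_assoc (monPivot K (i + 2) l), ← hc.eq,
        mul_assoc, mul_assoc, ← mul_sub, h]
      · cases hl : act l <;> simp [act, hl, monPivot]
      · exact partialD_commute_monPivot K l (by omega)
      · exact mulLetter_commute_monPivot K l (by omega)

/-- Since v_1 commutes with x_0, the first exponent is inert. -/
theorem lie_pivot_one_monPivot_cons (b : Bool) (l : List Bool) :
    ⁅pivot K 1, monPivot K 0 (b :: l)⁆ = (act l).elim 0 fun l' => monPivot K 0 (b :: l') := by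
  cases b with
  | false => exact lie_pivot_monPivot K l 1
  | true =>
    have h := lie_pivot_monPivot K l 1
    have hc := mulLetter_commute_pivot K (show 0 < 1 by omega)
    rw [Ring.lie_def] at h ⊢
    change _ * (_ * monPivot K 1 l) - (_ * monPivot K 1 l) * _ = _
    rw [← mul_assoc, ← hc.eq, mul_assoc, mul_assoc, ← mul_sub, h]
    cases act l <;> simp [monPivot]

/-! ### Linear independence of the monomial family -/

/-- Coordinate functionals for the monomials in `x_i, x_{i+1}, …`. -/
noncomputable def monDual : ℕ → List Bool → Grassmann K →ₗ[K] K
  | _, [] => (ExteriorAlgebra.algebraMapInv (R := K) (M := ℕ →₀ K)).toLinearMap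
  | i, true :: l => monDual (i + 1) l ∘ₗ partialD K i
  | i, false :: l => monDual (i + 1) l ∘ₗ partialD K i ∘ₗ mulLetter K i

theorem partialD_mon {j : ℕ} : ∀ (l : List Bool) (i : ℕ), j < i → partialD K j (mon K i l) = 0
  | [], i, _ => by
      rw [mon, ← map_one (algebraMap K _), partialD_algebraMap]
  | true :: l, i, h => by
      rw [mon, partialD_letter_mul, if_neg (by omega), partialD_mon l (i + 1) (by omega),
        mul_zero, add_zero]
  | false :: l, i, h => partialD_mon l (i + 1) (by omega)

theorem monDual_mon : ∀ (l l' : List Bool) (i : ℕ), l.length = l'.length →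
    monDual K i l (mon K i l') = if l = l' then 1 else 0
  | [], [], i, _ => by simp [monDual, mon]
  | [], _ :: _, i, h => by simp at h
  | _ :: _, [], i, h => by simp at h
  | true :: l, true :: l', i, h => by
      simp only [monDual, mon, LinearMap.comp_apply]
      rw [partialD_letter_mul, if_pos rfl, partialD_mon K l' (i + 1) (by omega), mul_zero,
        add_zero, monDual_mon l l' (i + 1) (by simpa using h)]
      simp
  | true :: l, false :: l', i, h => by
      simp only [monDual, mon, LinearMap.comp_apply]
      rw [partialD_mon K l' (i + 1) (by omega)]
      simp
  | false :: l, true :: l', i, h => by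
      simp only [monDual, mon, LinearMap.comp_apply, LinearMap.mulLeft_apply]
      rw [← mul_assoc, letter_mul_self]
      simp
  | false :: l, false :: l', i, h => by
      simp only [monDual, mon, LinearMap.comp_apply, LinearMap.mulLeft_apply]
      rw [partialD_letter_mul, if_pos rfl, partialD_mon K l' (i + 1) (by omega), mul_zero,
        add_zero, monDual_mon l l' (i + 1) (by simpa using h)]
      simp

theorem length_exponents {i j : Option (List Bool)} (h : pivotIndex i = pivotIndex j) :
    (exponents i).length = (exponents j).length := by
  cases i <;> cases j <;> simp_all [pivotIndex, exponents]

theorem eq_of_exponents {i j : Option (List Bool)} (h : pivotIndex i = pivotIndex j)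
    (h' : exponents i = exponents j) : i = j := by
  cases i <;> cases j <;> simp_all [pivotIndex, exponents]

/-- Evaluation at x_n kills every v_m with m > n and turns x^α v_n into x^α. Once the coefficients
with m < n are known to vanish, the distinct monomials x^α separate those with m = n. -/
theorem linearIndependent_basisElt : LinearIndependent K (basisElt K) := by
  rw [linearIndependent_iff']
  intro s g hg
  suffices h : ∀ n, ∀ i ∈ s, pivotIndex i = n → g i = 0 from fun i hi => h _ i hi rfl
  intro n
  induction n using Nat.strong_induction_on with
  | _ n ih =>
    intro i hi hin
    have h := congrArg (fun T : Module.End K (Grassmann K) =>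
      monDual K 0 (exponents i) (T (letter K n))) hg
    simp only [LinearMap.sum_apply, LinearMap.smul_apply, map_sum, map_smul,
      LinearMap.zero_apply, map_zero, basisElt_apply] at h
    rw [Finset.sum_eq_single i] at h
    · rw [hin, pivot_letter_self, mul_one, monDual_mon K _ _ _ rfl] at h
      simpa using h
    · intro j hj hji
      rcases lt_trichotomy (pivotIndex j) n with hlt | heq | hgt
      · rw [ih _ hlt j hj rfl, zero_smul]
      · rw [heq, pivot_letter_self, mul_one, monDual_mon K _ _ _ (length_exponents (by omega)),
          if_neg fun hh => hji (eq_of_exponents (by omega) hh.symm), smul_zero]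
      · rw [pivot_letter_of_lt K hgt, mul_zero, map_zero, smul_zero]
    · exact fun h => absurd hi h

end Operators

/-! ### Lie algebras with a basis adapted to the generators -/

section StandardBasis

variable {K L ι : Type*} [Field K] [LieRing L] [LieAlgebra K L]

/-- A weighted basis of a Lie algebra, such that `X` consists of its elements of weight one,
bracketing with `X` raises the weight by one, and reaches all basis elements of larger weight. -/
structure IsStandardBasis (b : Module.Basis ι K L) (wt : ι → ℕ) (X : Set L) : Prop where
  one_le : ∀ i, 1 ≤ wt i
  mem_iff : ∀ x, x ∈ X ↔ ∃ i, wt i = 1 ∧ b i = x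
  lie_mem : ∀ x ∈ X, ∀ i, ⁅x, b i⁆ ∈ Submodule.span K (b '' (wt ⁻¹' {wt i + 1}))
  exists_lie : ∀ j, 2 ≤ wt j → ∃ x ∈ X, ∃ i, wt i + 1 = wt j ∧ ⁅x, b i⁆ = b j

namespace IsStandardBasis

variable {b : Module.Basis ι K L} {wt : ι → ℕ} {X : Set L}

/-- The span of the basis elements with weight in `S`. -/
def weightSpan (b : Module.Basis ι K L) (wt : ι → ℕ) (S : Set ℕ) : Submodule K L :=
  Submodule.span K (b '' (wt ⁻¹' S))

theorem basis_mem_weightSpan {S : Set ℕ} {i : ι} (h : wt i ∈ S) : b i ∈ weightSpan b wt S :=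
  Submodule.subset_span ⟨i, h, rfl⟩

theorem weightSpan_mono {S T : Set ℕ} (h : S ⊆ T) : weightSpan b wt S ≤ weightSpan b wt T :=
  Submodule.span_mono (Set.image_mono (Set.preimage_mono h))

theorem weightSpan_univ : weightSpan b wt Set.univ = ⊤ := by
  rw [weightSpan, Set.preimage_univ, Set.image_univ, b.span_eq]

theorem disjoint_weightSpan {S T : Set ℕ} (h : Disjoint S T) :
    Disjoint (weightSpan b wt S) (weightSpan b wt T) :=
  b.linearIndependent.disjoint_span_image (h.preimage wt)

theorem weightSpan_union (S T : Set ℕ) :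
    weightSpan b wt (S ∪ T) = weightSpan b wt S ⊔ weightSpan b wt T := by
  rw [weightSpan, Set.preimage_union, Set.image_union, Submodule.span_union]
  rfl

theorem lie_mem_of_basis {x : L} {S : Set ℕ} {V : Submodule K L}
    (h : ∀ i, wt i ∈ S → ⁅x, b i⁆ ∈ V) {y : L} (hy : y ∈ weightSpan b wt S) : ⁅x, y⁆ ∈ V := by
  refine Submodule.span_induction (p := fun y _ => ⁅x, y⁆ ∈ V) ?_ ?_ ?_ ?_ hy
  · rintro _ ⟨i, hi, rfl⟩
    exact h i hi
  · rw [lie_zero]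
    exact V.zero_mem
  · intro y z _ _ hy hz
    rw [lie_add]
    exact V.add_mem hy hz
  · intro c y _ hy
    rw [lie_smul]
    exact V.smul_mem c hy

theorem mem_of_basis_lie {y : L} {S : Set ℕ} {V : Submodule K L}
    (h : ∀ i, wt i ∈ S → ⁅b i, y⁆ ∈ V) {x : L} (hx : x ∈ weightSpan b wt S) : ⁅x, y⁆ ∈ V := by
  rw [← lie_skew]
  refine V.neg_mem (lie_mem_of_basis (fun i hi => ?_) hx)
  rw [← lie_skew]
  exact V.neg_mem (h i hi)

variable (h : IsStandardBasis b wt X)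

include h

/-- Only brackets with elements of `X` are controlled by hypothesis. A left factor of larger weight
is itself a bracket with an element of `X`, and the Jacobi identity reduces its weight. -/
theorem basis_lie_mem (n : ℕ) : ∀ (i : ι), wt i = n → ∀ (m : ℕ), ∀ y ∈ weightSpan b wt {m},
    ⁅b i, y⁆ ∈ weightSpan b wt {n + m} := by
  have key : ∀ x ∈ X, ∀ (m : ℕ), ∀ y ∈ weightSpan b wt {m}, ⁅x, y⁆ ∈ weightSpan b wt {m + 1} := by
    intro x hx m y hy
    refine lie_mem_of_basis (fun i hi => ?_) hy
    have := h.lie_mem x hx i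
    rwa [Set.mem_singleton_iff.mp hi] at this
  induction n with
  | zero =>
    intro i hi
    have := h.one_le i
    omega
  | succ n ih =>
    intro i hi m y hy
    rcases Nat.eq_zero_or_pos n with rfl | hn
    · rw [zero_add, add_comm]
      exact key _ ((h.mem_iff _).2 ⟨i, hi, rfl⟩) m y hy
    · obtain ⟨x, hx, j, hj, hij⟩ := h.exists_lie i (by omega)
      rw [← hij, lie_lie]
      have h1 := key x hx _ _ (ih j (by omega) m y hy)
      have h2 := ih j (by omega) _ _ (key x hx m y hy)
      rw [show n + (m + 1) = n + 1 + m by omega] at h2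
      rw [show n + m + 1 = n + 1 + m by omega] at h1
      exact Submodule.sub_mem _ h1 h2

theorem lie_mem_weightSpan {m n : ℕ} {x y : L} (hx : x ∈ weightSpan b wt {m})
    (hy : y ∈ weightSpan b wt {n}) : ⁅x, y⁆ ∈ weightSpan b wt {m + n} :=
  mem_of_basis_lie (fun i hi => h.basis_lie_mem m i hi n y hy) hx

theorem basis_mem_degreeComponent (n : ℕ) : ∀ i, wt i = n → b i ∈ degreeComponent K X n := by
  induction n with
  | zero =>
    intro i hi
    have := h.one_le i
    omega
  | succ n ih =>
    intro i hi
    rcases Nat.eq_zero_or_pos n with rfl | hn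
    · exact Submodule.subset_span (.of _ ((h.mem_iff _).2 ⟨i, hi, rfl⟩))
    · obtain ⟨x, hx, j, hj, hij⟩ := h.exists_lie i (by omega)
      rw [← hij]
      refine Submodule.span_induction (p := fun y _ => ⁅x, y⁆ ∈ degreeComponent K X (n + 1))
        ?_ ?_ ?_ ?_ (ih j (by omega))
      · intro a ha
        rw [add_comm]
        exact Submodule.subset_span (.lie _ _ _ _ (.of x hx) ha)
      · rw [lie_zero]
        exact Submodule.zero_mem _
      · intro y z _ _ hy hz
        rw [lie_add]
        exact Submodule.add_mem _ hy hz
      · intro c y _ hy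
        rw [lie_smul]
        exact Submodule.smul_mem _ c hy

theorem degreeComponent_eq (n : ℕ) : degreeComponent K X n = weightSpan b wt {n} := by
  apply le_antisymm
  · refine Submodule.span_le.2 fun a ha => ?_
    induction ha with
    | of a ha =>
      obtain ⟨i, hi, rfl⟩ := (h.mem_iff a).1 ha
      exact basis_mem_weightSpan hi
    | lie m n x y _ _ hx hy => exact h.lie_mem_weightSpan hx hy
  · refine Submodule.span_le.2 ?_
    rintro _ ⟨i, hi, rfl⟩
    exact h.basis_mem_degreeComponent n i hi

theorem isLieGrading : IsLieGrading (degreeComponent K X) where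
  zero_eq_bot := by
    rw [h.degreeComponent_eq, eq_bot_iff]
    refine Submodule.span_le.2 ?_
    rintro _ ⟨i, hi, rfl⟩
    have := h.one_le i
    have : wt i = 0 := hi
    omega
  isInternal := by
    rw [DirectSum.isInternal_submodule_iff_iSupIndep_and_iSup_eq_top]
    have he : degreeComponent K X = fun n => weightSpan b wt {n} :=
      funext fun n => h.degreeComponent_eq n
    rw [he]
    constructor
    · intro n
      refine (disjoint_weightSpan (S := {n}) (T := {n}ᶜ) disjoint_compl_right).mono_right ?_
      exact iSup₂_le fun m hm => weightSpan_mono (by simpa [eq_comm] using hm)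
    · rw [eq_top_iff, ← b.span_eq]
      refine Submodule.span_le.2 ?_
      rintro _ ⟨i, rfl⟩
      exact Submodule.mem_iSup_of_mem (wt i) (basis_mem_weightSpan rfl)
  lie_mem m n x hx y hy := by
    rw [h.degreeComponent_eq] at *
    exact h.lie_mem_weightSpan hx hy

/-- All weights are at least 1, so each bracket with L raises the weight; conversely `exists_lie`
reaches every basis element of the next term from the current one. -/
theorem lowerCentralSeries_eq (n : ℕ) :
    (LieModule.lowerCentralSeries K L L n).toSubmodule = weightSpan b wt (Set.Ici (n + 1)) := by
  induction n with
  | zero =>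
    rw [LieModule.lowerCentralSeries_zero, LieSubmodule.top_toSubmodule, eq_comm, eq_top_iff,
      ← b.span_eq]
    refine Submodule.span_le.2 ?_
    rintro _ ⟨i, rfl⟩
    exact basis_mem_weightSpan (h.one_le i)
  | succ n ih =>
    rw [LieModule.lowerCentralSeries_succ, LieSubmodule.lieIdeal_oper_eq_linear_span']
    apply le_antisymm
    · refine Submodule.span_le.2 ?_
      rintro _ ⟨x, -, y, hy, rfl⟩
      rw [← LieSubmodule.mem_toSubmodule, ih] at hy
      have hx : x ∈ weightSpan b wt Set.univ := weightSpan_univ (b := b) ▸ Submodule.mem_top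
      refine mem_of_basis_lie (fun i _ => lie_mem_of_basis (fun j hj => ?_) hy) hx
      have := h.one_le i
      refine weightSpan_mono ?_ (h.lie_mem_weightSpan (basis_mem_weightSpan (i := i) rfl)
        (basis_mem_weightSpan (i := j) rfl))
      have : n + 1 ≤ wt j := hj
      simp only [Set.singleton_subset_iff, Set.mem_Ici]
      omega
    · refine Submodule.span_le.2 ?_
      rintro _ ⟨j, hj, rfl⟩
      have hj' : n + 1 + 1 ≤ wt j := hj
      obtain ⟨x, hx, i, hi, hij⟩ := h.exists_lie j (by omega)
      refine Submodule.subset_span ⟨x, LieSubmodule.mem_top x, b i, ?_, hij⟩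
      rw [← LieSubmodule.mem_toSubmodule, ih]
      exact basis_mem_weightSpan (show n + 1 ≤ wt i by omega)

theorem lowerCentral_eq {n : ℕ} (hn : 1 ≤ n) :
    lowerCentral K L n = weightSpan b wt (Set.Ici n) := by
  rw [lowerCentral, h.lowerCentralSeries_eq, Nat.sub_add_cancel hn]

/-- The component of weight n is a complement of L^{n+1} in L^n. -/
theorem rank_lowerCentralFactor {n : ℕ} (hn : 1 ≤ n) :
    Module.rank K (degreeComponent K X n) = Module.rank K (LowerCentralFactor K L n) := by
  rw [h.degreeComponent_eq]
  have hle : weightSpan b wt {n} ≤ lowerCentral K L n := by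
    rw [h.lowerCentral_eq hn]
    exact weightSpan_mono (by simp)
  set f : weightSpan b wt {n} →ₗ[K] LowerCentralFactor K L n :=
    ((lowerCentral K L (n + 1)).submoduleOf (lowerCentral K L n)).mkQ ∘ₗ
      Submodule.inclusion hle with hf
  refine LinearEquiv.rank_eq (LinearEquiv.ofBijective f ⟨?_, ?_⟩)
  · rw [← LinearMap.ker_eq_bot, LinearMap.ker_eq_bot']
    intro x hx
    rw [hf, LinearMap.comp_apply, Submodule.mkQ_apply, Submodule.Quotient.mk_eq_zero,
      Submodule.submoduleOf, Submodule.mem_comap] at hx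
    rw [h.lowerCentral_eq (by omega)] at hx
    have hd : Disjoint (weightSpan b wt {n}) (weightSpan b wt (Set.Ici (n + 1))) :=
      disjoint_weightSpan (by simp)
    exact Subtype.ext (Submodule.disjoint_def.1 hd _ x.2 hx)
  · intro q
    obtain ⟨⟨y, hy⟩, rfl⟩ := Submodule.Quotient.mk_surjective _ q
    have hy' := hy
    rw [h.lowerCentral_eq hn, show Set.Ici n = {n} ∪ Set.Ici (n + 1) by
      ext m; simp only [Set.mem_Ici, Set.mem_union, Set.mem_singleton_iff]; omega,
      weightSpan_union, Submodule.mem_sup] at hy'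
    obtain ⟨u, hu, v, hv, huv⟩ := hy'
    refine ⟨⟨u, hu⟩, ?_⟩
    rw [hf, LinearMap.comp_apply, Submodule.mkQ_apply, Submodule.Quotient.eq,
      Submodule.submoduleOf, Submodule.mem_comap, h.lowerCentral_eq (by omega)]
    have : u - y = -v := by rw [← huv]; abel
    simpa [this] using hv

theorem rank_degreeComponent {n : ℕ} (s : Finset ι) (hs : ∀ i, i ∈ s ↔ wt i = n) :
    Module.rank K (degreeComponent K X n) = s.card := by
  classical
  have hs' : wt ⁻¹' {n} = (s : Set ι) := Set.ext fun i => (hs i).symm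
  rw [h.degreeComponent_eq, weightSpan, hs', rank_span_set
    (b.linearIndependent.linearIndepOn s).id_image, ← Finset.coe_image]
  exact Cardinal.mk_coe_finset.trans (by rw [Finset.card_image_of_injective _ b.injective])

end IsStandardBasis

end StandardBasis

/-! ### Weights of the basis elements -/

/-- The degree `1, 1, 3, 5, 11, …` of `v_n`. -/
def pivotWeight : ℕ → ℕ
  | 0 => 1
  | 1 => 1
  | n + 2 => pivotWeight (n + 1) + 2 * pivotWeight n

theorem pivotWeight_pos : ∀ n, 1 ≤ pivotWeight n
  | 0 => le_rfl
  | 1 => le_rfl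
  | n + 2 => by
      have := pivotWeight_pos (n + 1)
      rw [pivotWeight]
      omega

/-- The contribution of the exponents of `x_i, x_{i+1}, …` to the degree of `x^α v_n`; as the
degree of `v_n` is `1 + 2 ∑_{i ≤ n - 2} deg v_i`, an absent letter contributes `2 deg v_i`, and
a present one contributes `deg v_i`. -/
def bitWeight : ℕ → List Bool → ℕ
  | _, [] => 0
  | i, true :: l => pivotWeight i + bitWeight (i + 1) l
  | i, false :: l => 2 * pivotWeight i + bitWeight (i + 1) l

/-- The degree of a basis element. -/
def basisWeight : Option (List Bool) → ℕ
  | none => 1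
  | some l => 1 + bitWeight 0 l

theorem one_le_bitWeight_cons (i : ℕ) (b : Bool) (l : List Bool) : 1 ≤ bitWeight i (b :: l) := by
  have := pivotWeight_pos i
  cases b <;> simp only [bitWeight] <;> omega

theorem basisWeight_eq_one_iff (i : Option (List Bool)) :
    basisWeight i = 1 ↔ i = none ∨ i = some [] := by
  match i with
  | none => simp [basisWeight]
  | some [] => simp [basisWeight, bitWeight]
  | some (b :: l) =>
    have := one_le_bitWeight_cons 0 b l
    simp only [basisWeight, reduceCtorEq, Option.some.injEq, or_self, iff_false]
    omega

/-- Write p_i for the weight of v_i. In the recursive case two letters appear, costing p_i +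
p_{i+1}, and the inner action gains p_{i+2} = p_{i+1} + 2 p_i; the balance is p_i. -/
theorem bitWeight_act : ∀ (l l' : List Bool) (i : ℕ), act l = some l' →
    bitWeight i l' = bitWeight i l + pivotWeight i
  | [], _, i, h => by
      obtain rfl := Option.some.inj h
      simp [bitWeight]
  | true :: l, _, i, h => by
      obtain rfl := Option.some.inj h
      simp only [bitWeight]
      omega
  | [false], _, i, h => by simp [act] at h
  | false :: true :: l, _, i, h => by simp [act] at h
  | false :: false :: l, l', i, h => by
      obtain ⟨l'', hl, rfl⟩ := Option.map_eq_some_iff.1 h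
      have := bitWeight_act l l'' (i + 2) hl
      simp only [bitWeight, this, pivotWeight, Nat.add_assoc, Nat.reduceAdd]
      omega

/-- The first alternative is an image under v_0. The second is an image under v_1, which leaves the
leading x_0 alone. Two leading letters are removed in the recursion because `act` creates them in
pairs. -/
theorem exists_act_eq : ∀ l : List Bool, l ≠ [] →
    (∃ l', act l' = some l) ∨ ∃ l', l = true :: l' ∧ ∃ l'', act l'' = some l'
  | [], h => absurd rfl h
  | false :: l, _ => .inl ⟨true :: l, rfl⟩
  | [true], _ => .inl ⟨[], rfl⟩
  | true :: false :: l, _ => .inr ⟨_, rfl, true :: l, rfl⟩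
  | [true, true], _ => .inr ⟨_, rfl, [], rfl⟩
  | true :: true :: b :: l, _ => by
      rcases exists_act_eq (b :: l) (by simp) with ⟨l', hl⟩ | ⟨l', hl, l'', hl'⟩
      · exact .inl ⟨false :: false :: l', by simp [act, hl]⟩
      · refine .inr ⟨_, rfl, false :: false :: l'', ?_⟩
        simp [act, hl', hl]

/-! ### The monomial family is a basis of R -/

section Basis

attribute [local instance 100] LieRing.ofAssociativeRing

variable (K : Type*) [Field K]

theorem pivot_zero_mem : pivot K 0 ∈ R K := LieSubalgebra.subset_lieSpan (by simp)

theorem pivot_one_mem : pivot K 1 ∈ R K := LieSubalgebra.subset_lieSpan (by simp)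

theorem mem_gens_iff (x : R K) :
    x ∈ gens K ↔ (x : Module.End K (Grassmann K)) = pivot K 0 ∨
      (x : Module.End K (Grassmann K)) = pivot K 1 := by
  simp [gens]

/-- The subalgebra `R`, being generated by `v_0` and `v_1`, preserves every subspace preserved by
these two. -/
theorem lie_mem_of_mem_R (W : Submodule K (Module.End K (Grassmann K)))
    (h0 : ∀ y ∈ W, ⁅pivot K 0, y⁆ ∈ W) (h1 : ∀ y ∈ W, ⁅pivot K 1, y⁆ ∈ W)
    {x : Module.End K (Grassmann K)} (hx : x ∈ R K) : ∀ y ∈ W, ⁅x, y⁆ ∈ W := by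
  induction hx using LieSubalgebra.lieSpan_induction with
  | mem x hx =>
    rcases hx with rfl | rfl
    · exact h0
    · exact h1
  | zero => simp
  | add x y _ _ hx hy =>
    intro z hz
    rw [add_lie]
    exact W.add_mem (hx z hz) (hy z hz)
  | smul c x _ hx =>
    intro z hz
    rw [smul_lie]
    exact W.smul_mem c (hx z hz)
  | lie x y _ _ hx hy =>
    intro z hz
    rw [lie_lie]
    exact W.sub_mem (hx _ (hy z hz)) (hy _ (hx z hz))

theorem elim_mem_span_basisElt (o : Option (List Bool)) :
    (o.elim 0 fun l => basisElt K (some l)) ∈ Submodule.span K (Set.range (basisElt K)) := by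
  cases o with
  | none => exact Submodule.zero_mem _
  | some l => exact Submodule.subset_span ⟨some l, rfl⟩

variable [CharP K 2]

theorem end_lie_comm (x y : Module.End K (Grassmann K)) : ⁅x, y⁆ = ⁅y, x⁆ := by
  rw [← lie_skew, end_neg]

/-- The action of `v_0` on the basis. -/
def actZero : Option (List Bool) → Option (List Bool)
  | none => none
  | some l => act l

/-- The action of `v_1` on the basis. -/
def actOne : Option (List Bool) → Option (List Bool)
  | none => some [true]
  | some [] => none
  | some (b :: l) => (act l).map (b :: ·)

theorem lie_pivot_zero_basisElt (i : Option (List Bool)) :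
    ⁅pivot K 0, basisElt K i⁆ = (actZero i).elim 0 fun l => basisElt K (some l) := by
  cases i with
  | none => exact lie_self _
  | some l => exact lie_pivot_monPivot K l 0

theorem lie_pivot_one_basisElt (i : Option (List Bool)) :
    ⁅pivot K 1, basisElt K i⁆ = (actOne i).elim 0 fun l => basisElt K (some l) := by
  match i with
  | none =>
    rw [end_lie_comm]
    exact lie_pivot_monPivot K [] 0
  | some [] => exact lie_self _
  | some (b :: l) =>
    refine (lie_pivot_one_monPivot_cons K b l).trans ?_
    cases h : act l <;> simp [actOne, h, basisElt]

theorem basisWeight_actZero {i : Option (List Bool)} {l : List Bool} (h : actZero i = some l) :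
    basisWeight (some l) = basisWeight i + 1 := by
  cases i with
  | none => simp [actZero] at h
  | some l' =>
    have := bitWeight_act l' l 0 h
    simp only [basisWeight, this, pivotWeight]
    omega

theorem basisWeight_actOne {i : Option (List Bool)} {l : List Bool} (h : actOne i = some l) :
    basisWeight (some l) = basisWeight i + 1 := by
  match i, h with
  | none, h =>
    obtain rfl := Option.some.inj h
    simp [basisWeight, bitWeight, pivotWeight]
  | some (b :: l'), h =>
    obtain ⟨l'', hl, rfl⟩ := Option.map_eq_some_iff.1 h
    have := bitWeight_act l' l'' 1 hl
    cases b <;> simp only [basisWeight, bitWeight, this, pivotWeight, zero_add] <;> omega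

theorem exists_actZero_or_actOne (j : Option (List Bool)) (hj : 2 ≤ basisWeight j) :
    ∃ l, j = some l ∧ ∃ i, actZero i = some l ∨ actOne i = some l := by
  match j with
  | none => simp [basisWeight] at hj
  | some l =>
    refine ⟨l, rfl, ?_⟩
    have hl : l ≠ [] := by
      rintro rfl
      simp [basisWeight, bitWeight] at hj
    rcases exists_act_eq l hl with ⟨l', h⟩ | ⟨l', rfl, l'', h⟩
    · exact ⟨some l', .inl h⟩
    · exact ⟨some (true :: l''), .inr (by simp [actOne, h])⟩

theorem basisElt_mem_R (i : Option (List Bool)) : basisElt K i ∈ R K := by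
  suffices h : ∀ n, ∀ i, basisWeight i = n → basisElt K i ∈ R K from h _ i rfl
  intro n
  induction n using Nat.strong_induction_on with
  | _ n ih =>
    intro j hj
    by_cases h2 : 2 ≤ basisWeight j
    · obtain ⟨l, rfl, i, hi | hi⟩ := exists_actZero_or_actOne j h2
      · have h := lie_pivot_zero_basisElt K i
        rw [hi, Option.elim] at h
        rw [← h]
        have := basisWeight_actZero hi
        exact (R K).lie_mem (pivot_zero_mem K) (ih _ (by omega) i rfl)
      · have h := lie_pivot_one_basisElt K i
        rw [hi, Option.elim] at h
        rw [← h]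
        have := basisWeight_actOne hi
        exact (R K).lie_mem (pivot_one_mem K) (ih _ (by omega) i rfl)
    · have h1 : basisWeight j = 1 := by
        have : 1 ≤ basisWeight j := by cases j <;> simp [basisWeight]
        omega
      rcases (basisWeight_eq_one_iff j).1 h1 with rfl | rfl
      · exact pivot_zero_mem K
      · exact pivot_one_mem K

/-- The span contains v_0 and v_1 and is stable under bracketing with them, hence with all of R; no
bracket of two general basis elements has to be computed. -/
theorem mem_span_basisElt {x : Module.End K (Grassmann K)} (hx : x ∈ R K) :
    x ∈ Submodule.span K (Set.range (basisElt K)) := by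
  set W := Submodule.span K (Set.range (basisElt K)) with hW
  have closed : ∀ v : Module.End K (Grassmann K), (∀ i, ⁅v, basisElt K i⁆ ∈ W) →
      ∀ y ∈ W, ⁅v, y⁆ ∈ W := by
    intro v hv y hy
    refine Submodule.span_induction (p := fun y _ => ⁅v, y⁆ ∈ W) ?_ ?_ ?_ ?_ hy
    · rintro _ ⟨i, rfl⟩
      exact hv i
    · rw [lie_zero]
      exact W.zero_mem
    · intro y z _ _ hy hz
      rw [lie_add]
      exact W.add_mem hy hz
    · intro c y _ hy
      rw [lie_smul]
      exact W.smul_mem c hy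
  have stable {r : Module.End K (Grassmann K)} (hr : r ∈ R K) : ∀ y ∈ W, ⁅r, y⁆ ∈ W := by
    refine lie_mem_of_mem_R K W (closed _ fun i => ?_) (closed _ fun i => ?_) hr
    · rw [lie_pivot_zero_basisElt]
      exact elim_mem_span_basisElt K _
    · rw [lie_pivot_one_basisElt]
      exact elim_mem_span_basisElt K _
  induction hx using LieSubalgebra.lieSpan_induction with
  | mem x hx =>
    rcases hx with rfl | rfl
    · exact Submodule.subset_span ⟨none, rfl⟩
    · exact Submodule.subset_span ⟨some [], rfl⟩
  | zero => exact W.zero_mem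
  | add x y _ _ hx hy => exact W.add_mem hx hy
  | smul c x _ hx => exact W.smul_mem c hx
  | lie x y hxR _ _ hy => exact stable hxR _ hy

/-- The basis of `R` consisting of `v_0` and the elements `x^α v_n`. -/
noncomputable def basisR : Module.Basis (Option (List Bool)) K (R K) :=
  Module.Basis.mk (v := fun i => (⟨basisElt K i, basisElt_mem_R K i⟩ : R K))
    (LinearIndependent.of_comp (R K).toSubmodule.subtype (linearIndependent_basisElt K)) (by
      rintro ⟨x, hx⟩ -
      have h := mem_span_basisElt K hx
      refine (Function.Injective.mem_set_image Subtype.val_injective).1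
        (?_ : _ ∈ (R K).toSubmodule.subtype '' _)
      rw [← Submodule.map_coe, Submodule.map_span, ← Set.range_comp]
      exact h)

theorem coe_basisR (i : Option (List Bool)) :
    (basisR K i : Module.End K (Grassmann K)) = basisElt K i := by
  simp [basisR]

theorem isStandardBasis_basisR : IsStandardBasis (basisR K) basisWeight (gens K) where
  one_le i := by cases i <;> simp [basisWeight]
  mem_iff x := by
    rw [mem_gens_iff]
    constructor
    · rintro (h | h)
      · exact ⟨none, rfl, Subtype.ext ((coe_basisR K _).trans h.symm)⟩
      · exact ⟨some [], rfl, Subtype.ext ((coe_basisR K _).trans h.symm)⟩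
    · rintro ⟨i, hi, rfl⟩
      rw [coe_basisR]
      rcases (basisWeight_eq_one_iff i).1 hi with rfl | rfl
      · exact .inl rfl
      · exact .inr rfl
  lie_mem x hx i := by
    have key : ∀ o : Option (List Bool), (∀ l, o = some l → basisWeight (some l) = basisWeight i + 1) →
        ((⁅x, basisR K i⁆ : R K) : Module.End K (Grassmann K)) = o.elim 0 (fun l => basisElt K (some l)) →
        ⁅x, basisR K i⁆ ∈ Submodule.span K
          (basisR K '' (basisWeight ⁻¹' {basisWeight i + 1})) := by
      rintro (_ | l) ho h
      · have h' : ⁅x, basisR K i⁆ = 0 := Subtype.ext h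
        rw [h']
        exact Submodule.zero_mem _
      · have h' : ⁅x, basisR K i⁆ = basisR K (some l) :=
          Subtype.ext (h.trans (coe_basisR K (some l)).symm)
        rw [h']
        exact Submodule.subset_span ⟨_, ho l rfl, rfl⟩
    rcases (mem_gens_iff K x).1 hx with h | h
    · refine key (actZero i) (fun l => basisWeight_actZero) ?_
      rw [LieSubalgebra.coe_bracket, h, coe_basisR, lie_pivot_zero_basisElt]
    · refine key (actOne i) (fun l => basisWeight_actOne) ?_
      rw [LieSubalgebra.coe_bracket, h, coe_basisR, lie_pivot_one_basisElt]
  exists_lie j hj := by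
    obtain ⟨l, rfl, i, hi | hi⟩ := exists_actZero_or_actOne j hj
    · refine ⟨⟨_, pivot_zero_mem K⟩, (mem_gens_iff K _).2 (.inl rfl), i,
        (basisWeight_actZero hi).symm, Subtype.ext ?_⟩
      rw [LieSubalgebra.coe_bracket, coe_basisR, coe_basisR, lie_pivot_zero_basisElt, hi,
        Option.elim]
    · refine ⟨⟨_, pivot_one_mem K⟩, (mem_gens_iff K _).2 (.inr rfl), i,
        (basisWeight_actOne hi).symm, Subtype.ext ?_⟩
      rw [LieSubalgebra.coe_bracket, coe_basisR, coe_basisR, lie_pivot_one_basisElt, hi,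
        Option.elim]

end Basis

/-! ### The counting words and their substitution -/

section Words

theorem pivotWeight_succ (m : ℕ) :
    pivotWeight (m + 1) + 1 = 2 * pivotWeight m + 2 * (m % 2) := by
  induction m with
  | zero => rfl
  | succ m ih =>
    rw [pivotWeight]
    omega

theorem le_pivotWeight : ∀ m, m ≤ pivotWeight m
  | 0 => by simp
  | 1 => le_rfl
  | m + 2 => by
      have := le_pivotWeight (m + 1)
      have := pivotWeight_pos m
      rw [pivotWeight]
      omega

/-- Juxtaposition of words; for odd `m` the last letter `1` of the first word and the first letter
`1` of the second word are merged into a letter `2`. -/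
def glue (m : ℕ) (l l' : List ℕ) : List ℕ :=
  if m % 2 = 0 then l ++ l' else l.dropLast ++ 2 :: l'.tail

theorem glue_even {m : ℕ} (hm : m % 2 = 0) (l l' : List ℕ) : glue m l l' = l ++ l' := if_pos hm

theorem glue_odd {m : ℕ} (hm : m % 2 = 1) (u v : List ℕ) :
    glue m (u ++ [1]) (1 :: v) = u ++ 2 :: v := by
  simp [glue, hm]

theorem getD_append (l l' : List ℕ) (j : ℕ) : (l ++ l').getD j 0 =
    l.getD j 0 + if l.length ≤ j then l'.getD (j - l.length) 0 else 0 := by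
  split_ifs with h
  · rw [List.getD_append_right _ _ _ _ h, List.getD_eq_default l _ h, zero_add]
  · rw [List.getD_append _ _ _ _ (by omega), add_zero]

/-- Gluing is addition of two sequences after a shift. For odd m the shift is one less than the
length, and the overlapping letters add up to 1 + 1 = 2. -/
theorem getD_glue (m : ℕ) {l l' : List ℕ} (hl : m % 2 = 1 → ∃ u, l = u ++ [1])
    (hl' : ∃ v, l' = 1 :: v) (j : ℕ) : (glue m l l').getD j 0 =
      l.getD j 0 + if l.length - m % 2 ≤ j then l'.getD (j - (l.length - m % 2)) 0 else 0 := by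
  rcases Nat.mod_two_eq_zero_or_one m with hm | hm
  · rw [glue_even hm, hm, getD_append, Nat.sub_zero]
  · obtain ⟨u, rfl⟩ := hl hm
    obtain ⟨v, rfl⟩ := hl'
    rw [glue_odd hm, hm, getD_append, getD_append, List.length_append, List.length_singleton,
      Nat.add_sub_cancel]
    split_ifs with h
    · rcases h' : j - u.length with _ | k <;> simp
    · rfl

/-- The numbers of the elements `x^α v_{m+1}` of successive degrees. -/
def word : ℕ → List ℕ
  | 0 => [1]
  | m + 1 => glue m (word m) (word m)

/-- The numbers of the elements `x^α v_n`, `2 ≤ n ≤ m + 1`, of the successive degrees `≥ 2`. -/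
def totalWord : ℕ → List ℕ
  | 0 => []
  | m + 1 => glue m (totalWord m) (word (m + 1))

/-- The last clause says that for odd m the first and last letters are different occurrences, so
that merging in the middle leaves a letter 1 at both ends. -/
theorem word_ends (m : ℕ) : (∃ v, word m = 1 :: v) ∧ ∃ u, word m = u ++ [1] ∧
    (m % 2 = 1 → ∃ u', u = 1 :: u') := by
  induction m with
  | zero => exact ⟨⟨[], rfl⟩, [], rfl, by simp⟩
  | succ m ih =>
    obtain ⟨⟨v, hv⟩, u, hu, hu'⟩ := ih
    rcases Nat.mod_two_eq_zero_or_one m with hm | hm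
    · rw [word, glue_even hm]
      refine ⟨⟨v ++ word m, by rw [hv]; rfl⟩, word m ++ u, by nth_rw 2 [hu]; simp, fun _ => ?_⟩
      exact ⟨v ++ u, by rw [hv]; rfl⟩
    · obtain ⟨u', rfl⟩ := hu' hm
      have h : word (m + 1) = 1 :: u' ++ 2 :: v := by
        rw [word]
        nth_rw 1 [hu]
        rw [hv, glue_odd hm]
      rw [h]
      have hv' : v = u' ++ [1] := by simpa [hv] using hu
      exact ⟨⟨_, rfl⟩, 1 :: u' ++ 2 :: u', by simp [hv'], fun _ => ⟨_, rfl⟩⟩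

theorem length_glue (m : ℕ) {l l' : List ℕ} (hl : m % 2 = 1 → l ≠ []) (hl' : l' ≠ []) :
    (glue m l l').length + m % 2 = l.length + l'.length := by
  have h2 := List.length_pos_iff.2 hl'
  rcases Nat.mod_two_eq_zero_or_one m with hm | hm
  · rw [glue_even hm, hm, List.length_append, add_zero]
  · have h1 := List.length_pos_iff.2 (hl hm)
    simp [glue, hm]
    omega

theorem word_ne_nil (m : ℕ) : word m ≠ [] := by
  obtain ⟨v, hv⟩ := (word_ends m).1
  simp [hv]

theorem length_word (m : ℕ) : (word m).length = pivotWeight m + m % 2 := by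
  induction m with
  | zero => rfl
  | succ m ih =>
    have h := length_glue m (fun _ => word_ne_nil m) (word_ne_nil m)
    have := pivotWeight_succ m
    rw [word]
    omega

theorem totalWord_end {m : ℕ} (hm : m % 2 = 1) : ∃ u, totalWord m = u ++ [1] := by
  obtain ⟨m, rfl⟩ : ∃ k, m = k + 1 := ⟨m - 1, by omega⟩
  obtain ⟨u, hu, -⟩ := (word_ends (m + 1)).2
  exact ⟨totalWord m ++ u, by rw [totalWord, glue_even (by omega), hu, List.append_assoc]⟩

theorem length_totalWord (m : ℕ) : (totalWord m).length + 1 = pivotWeight (m + 1) := by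
  induction m with
  | zero => rfl
  | succ m ih =>
    have h := length_glue m (l := totalWord m) (fun hm => by
      obtain ⟨u, hu⟩ := totalWord_end hm
      simp [hu]) (word_ne_nil (m + 1))
    have := pivotWeight_succ (m + 1)
    have := length_word (m + 1)
    rw [totalWord]
    omega

/-- The substitution `1 ↦ 112`, `2 ↦ 11222`. -/
def subst (l : List ℕ) : List ℕ := l.flatMap fun a => 1 :: 1 :: List.replicate (2 * a - 1) 2

theorem subst_append (l l' : List ℕ) : subst (l ++ l') = subst l ++ subst l' :=
  List.flatMap_append

theorem subst_cons (a : ℕ) (l : List ℕ) :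
    subst (a :: l) = 1 :: 1 :: List.replicate (2 * a - 1) 2 ++ subst l := List.flatMap_cons

/-- For even m the trailing 1 of the first image supplies the missing first letter of the second.
For odd m that 1 merges with the next 1, so 112 followed by 112 becomes 11222, the image of the
merged letter 2. -/
theorem glue_subst (m : ℕ) {p l l₁ l' l₁' : List ℕ} (hl : m % 2 = 1 → ∃ u, l = u ++ [1])
    (hl' : ∃ v, l' = 1 :: v) (h : l₁ = p ++ subst l ++ [1]) (h' : 1 :: l₁' = subst l' ++ [1]) :
    glue m l₁ l₁' = p ++ subst (glue m l l') ++ [1] := by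
  rcases Nat.mod_two_eq_zero_or_one m with hm | hm
  · rw [glue_even hm, glue_even hm, subst_append, h, List.append_assoc _ [1], List.singleton_append,
      h']
    simp
  · obtain ⟨u, rfl⟩ := hl hm
    obtain ⟨v, rfl⟩ := hl'
    obtain rfl : l₁' = 1 :: 2 :: (subst v ++ [1]) := by
      simpa [subst_cons] using h'
    rw [glue_odd hm, h, glue_odd hm, subst_append, subst_append, subst_cons, subst_cons]
    simp [List.replicate, subst]

theorem cons_glue (m : ℕ) (a : ℕ) {l : List ℕ} (hl : l ≠ []) (l' : List ℕ) :
    a :: glue m l l' = glue m (a :: l) l' := by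
  rw [glue, glue]
  split_ifs
  · rfl
  · rw [List.dropLast_cons_of_ne_nil hl]
    rfl

theorem cons_word (m : ℕ) : 1 :: word (m + 2) = subst (word m) ++ [1] := by
  induction m with
  | zero => rfl
  | succ m ih =>
    -- `glue` depends only on the parity of its index.
    have h : glue (m + 2) (1 :: word (m + 2)) (word (m + 2)) =
        glue m (1 :: word (m + 2)) (word (m + 2)) := by simp [glue]
    obtain ⟨h1, u, hu, -⟩ := word_ends m
    rw [word, cons_glue _ _ (word_ne_nil _), h,
      glue_subst m (p := []) (fun _ => ⟨u, hu⟩) h1 ih ih]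
    rfl

/-- The prefix 1, 2, 2 accounts for degrees 2, 3, 4, which is why the blocks start at degree 5. -/
theorem totalWord_add_two (m : ℕ) :
    totalWord (m + 2) = [1, 2, 2] ++ subst (totalWord m) ++ [1] := by
  induction m with
  | zero => rfl
  | succ m ih =>
    have h : totalWord (m + 1 + 2) = glue m (totalWord (m + 2)) (word (m + 3)) := by
      simp [totalWord, glue]
    rw [h, glue_subst m totalWord_end (word_ends (m + 1)).1 ih (cons_word (m + 1))]
    rfl

theorem mem_totalWord {m a : ℕ} (h : a ∈ totalWord (m + 2)) : a = 1 ∨ a = 2 := by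
  rw [totalWord_add_two] at h
  simp [subst, List.mem_replicate] at h
  omega

end Words

/-! ### Counting bit lists by weight -/

section Counting

/-- The lists of bits of length `m`. -/
def bitLists : ℕ → Finset (List Bool)
  | 0 => {[]}
  | m + 1 => (bitLists m).image (· ++ [true]) ∪ (bitLists m).image (· ++ [false])

theorem mem_bitLists : ∀ (m : ℕ) (l : List Bool), l ∈ bitLists m ↔ l.length = m
  | 0, l => by simp [bitLists]
  | m + 1, l => by
      rcases List.eq_nil_or_concat l with rfl | ⟨l, b, rfl⟩
      · simp [bitLists]
      · cases b <;> simp [bitLists, mem_bitLists m]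

theorem bitWeight_append_singleton (b : Bool) : ∀ (l : List Bool) (i : ℕ),
    bitWeight i (l ++ [b]) = bitWeight i l + (if b then 1 else 2) * pivotWeight (i + l.length)
  | [], i => by cases b <;> simp [bitWeight]
  | true :: l, i => by
      have h : i + (true :: l).length = i + 1 + l.length := by simp; omega
      rw [List.cons_append, bitWeight, bitWeight, bitWeight_append_singleton b l, ← h, add_assoc]
  | false :: l, i => by
      have h : i + (false :: l).length = i + 1 + l.length := by simp; omega
      rw [List.cons_append, bitWeight, bitWeight, bitWeight_append_singleton b l, ← h, add_assoc]

/-- The number of bit lists of given length and weight. -/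
def bitCount (m v : ℕ) : ℕ := ((bitLists m).filter fun l => bitWeight 0 l = v).card

theorem card_filter_image_append (m v : ℕ) (b : Bool) :
    (((bitLists m).image (· ++ [b])).filter fun l => bitWeight 0 l = v).card =
      if (if b then 1 else 2) * pivotWeight m ≤ v then
        bitCount m (v - (if b then 1 else 2) * pivotWeight m) else 0 := by
  rw [Finset.filter_image, Finset.card_image_of_injective _ (List.append_left_injective _)]
  have h : ∀ l ∈ bitLists m, bitWeight 0 (l ++ [b]) =
      bitWeight 0 l + (if b then 1 else 2) * pivotWeight m := fun l hl => by
    rw [bitWeight_append_singleton, (mem_bitLists m l).1 hl, zero_add]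
  generalize (if b then 1 else 2) * pivotWeight m = c at h ⊢
  split_ifs with hv
  · rw [bitCount]
    congr 1
    refine Finset.filter_congr fun l hl => ?_
    rw [h l hl]
    omega
  · rw [Finset.card_eq_zero, Finset.filter_eq_empty_iff]
    intro l hl
    rw [h l hl]
    omega

theorem bitCount_succ (m v : ℕ) : bitCount (m + 1) v =
    (if pivotWeight m ≤ v then bitCount m (v - pivotWeight m) else 0) +
      if 2 * pivotWeight m ≤ v then bitCount m (v - 2 * pivotWeight m) else 0 := by
  have h1 := card_filter_image_append m v true
  have h2 := card_filter_image_append m v false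
  simp only [if_true, one_mul, Bool.false_eq_true, if_false] at h1 h2
  rw [bitCount, bitLists, Finset.filter_union, Finset.card_union_of_disjoint, h1, h2]
  refine Finset.disjoint_filter_filter (Finset.disjoint_left.2 fun l hl hl' => ?_)
  obtain ⟨l₁, -, rfl⟩ := Finset.mem_image.1 hl
  obtain ⟨l₂, -, h⟩ := Finset.mem_image.1 hl'
  simpa using List.append_inj_right' h rfl

/-- The least weight of a list of length m is p_0 + ⋯ + p_{m-1}, one less than the length of `word
m`; hence the offset. A present or absent x_m adds p_m or 2 p_m, so the two copies differ by p_m,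
exactly the shift in `glue`. -/
theorem bitCount_eq (m : ℕ) : ∀ v, bitCount m v =
    if (word m).length ≤ v + 1 then (word m).getD (v + 1 - (word m).length) 0 else 0 := by
  induction m with
  | zero =>
    intro v
    rcases v with _ | v <;> simp [bitCount, bitLists, word, bitWeight, Finset.filter_singleton]
  | succ m ih =>
    intro v
    obtain ⟨h1, u, hu, -⟩ := word_ends m
    have hl := length_word m
    have hl' := length_word (m + 1)
    have hw := pivotWeight_succ m
    have hp := pivotWeight_pos m
    have hg := getD_glue m (fun _ => ⟨u, hu⟩) h1 (v + 1 - (word (m + 1)).length)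
    rw [← word] at hg
    rw [bitCount_succ, ih, ih, hg]
    have e1 : (word m).length - m % 2 = pivotWeight m := by omega
    rw [e1]
    have e2 : (word (m + 1)).length = pivotWeight m + (word m).length := by omega
    rw [e2]
    by_cases c1 : pivotWeight m + (word m).length ≤ v + 1
    · rw [if_pos c1, if_pos (by omega), if_pos (by omega)]
      congr 1
      · congr 1
        omega
      · by_cases c2 : 2 * pivotWeight m ≤ v
        · by_cases c3 : (word m).length ≤ v - 2 * pivotWeight m + 1
          · rw [if_pos c2, if_pos c3, if_pos (by omega)]
            congr 1
            omega
          · rw [if_pos c2, if_neg c3, if_neg (by omega)]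
        · rw [if_neg c2, if_neg (by omega)]
    · rw [if_neg c1]
      split_ifs <;> first | rfl | omega

theorem sum_bitCount (M j : ℕ) :
    ∑ m ∈ Finset.range (M + 1), bitCount m (j + 1) = (totalWord M).getD j 0 := by
  induction M with
  | zero => simp [bitCount, bitLists, bitWeight, totalWord, Finset.filter_singleton]
  | succ M ih =>
    have hl := length_word (M + 1)
    have hw := length_totalWord M
    have hp := pivotWeight_pos (M + 1)
    rw [Finset.sum_range_succ, ih, bitCount_eq, totalWord,
      getD_glue M totalWord_end (word_ends (M + 1)).1]
    -- The second alternative is where the subtraction truncates; it is impossible, since for odd M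
    -- the word ends in 1.
    have e : (word (M + 1)).length = (totalWord M).length - M % 2 + 2 ∨
      M % 2 = 1 ∧ (totalWord M).length = 0 := by omega
    rcases e with e | ⟨e1, e2⟩
    · congr 1
      rw [e]
      split_ifs
      · congr 1
        omega
      · omega
      · omega
      · rfl
    · obtain ⟨u, hu⟩ := totalWord_end e1
      simp [hu] at e2

end Counting

/-! ### Blocks, self-similarity and aperiodicity -/

section Pattern

/-- The starting position of the `j`-th block in the sequence of dimensions. -/
def blockStart (a : ℕ → ℕ) : ℕ → ℕ
  | 0 => 5
  | j + 1 => blockStart a j + 2 + (2 * a (j + 2) - 1)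

theorem getElem_totalWord {a : ℕ → ℕ}
    (ha : ∀ j M, j + 1 ≤ M → a (j + 2) = (totalWord M).getD j 0) {j M : ℕ} (h : j + 1 ≤ M) :
    ∃ hj : j < (totalWord M).length, (totalWord M)[j] = a (j + 2) := by
  have h1 := length_totalWord M
  have h2 := le_pivotWeight (M + 1)
  have h3 : j < (totalWord M).length := by omega
  exact ⟨h3, by rw [ha j M h, List.getD_eq_getElem _ _ h3]⟩

theorem length_subst_take {a : ℕ → ℕ}
    (ha : ∀ j M, j + 1 ≤ M → a (j + 2) = (totalWord M).getD j 0) {M : ℕ} :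
    ∀ j, j ≤ M → (subst ((totalWord M).take j)).length + 5 = blockStart a j
  | 0, _ => by simp [subst, blockStart]
  | j + 1, h => by
      have ih := length_subst_take ha j (M := M) (by omega)
      obtain ⟨hj, he⟩ := getElem_totalWord ha h
      rw [List.take_add_one, List.getElem?_eq_getElem hj, he, blockStart, ← ih, subst_append]
      simp [subst]
      omega

theorem eq_one_or_two {a : ℕ → ℕ}
    (ha : ∀ j M, j + 1 ≤ M → a (j + 2) = (totalWord M).getD j 0) (j : ℕ) :
    a (j + 2) = 1 ∨ a (j + 2) = 2 := by
  obtain ⟨hj, he⟩ := getElem_totalWord ha (show j + 1 ≤ j + 1 + 2 by omega)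
  rw [← he]
  exact mem_totalWord (m := j + 1) (List.getElem_mem hj)

/-- The word is cut at its letter of index j: the images of the earlier letters, together with the
prefix 1, 2, 2, end just before `blockStart a j`, where the image of this letter begins. -/
theorem block_eq {a : ℕ → ℕ}
    (ha : ∀ j M, j + 1 ≤ M → a (j + 2) = (totalWord M).getD j 0) (j i : ℕ)
    (hi : i < 2 + (2 * a (j + 2) - 1)) :
    a (blockStart a j + i) = (1 :: 1 :: List.replicate (2 * a (j + 2) - 1) 2).getD i 0 := by
  have hs : 5 ≤ blockStart a j := by
    cases j <;> simp only [blockStart]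
    · exact le_rfl
    · rename_i j
      have := length_subst_take ha j le_rfl
      omega
  -- Any M large enough to reach both the letter of index j and the position in its image would do.
  set M := blockStart a j + i + j with hM
  have hlen := length_subst_take ha j (M := M) (by omega)
  obtain ⟨hj, he⟩ := getElem_totalWord ha (show j + 1 ≤ M by omega)
  have hT : totalWord M = (totalWord M).take j ++ a (j + 2) :: (totalWord M).drop (j + 1) := by
    rw [← he, ← List.drop_eq_getElem_cons hj, List.take_append_drop]
  have h := ha (blockStart a j + i - 2) (M + 2) (by omega)
  rw [show blockStart a j + i - 2 + 2 = blockStart a j + i by omega] at h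
  rw [h, totalWord_add_two, hT, subst_append, subst_cons]
  set p := subst ((totalWord M).take j) with hp
  set w := 1 :: 1 :: List.replicate (2 * a (j + 2) - 1) 2 with hw
  set r := subst ((totalWord M).drop (j + 1)) with hr
  have e : blockStart a j + i - 2 = ([1, 2, 2] ++ p).length + i := by
    simp only [List.length_append, List.length_cons, List.length_nil]
    omega
  have e' : [1, 2, 2] ++ (p ++ (w ++ r)) ++ [1] = ([1, 2, 2] ++ p) ++ (w ++ (r ++ [1])) := by simp
  rw [e', List.getD_append_right _ _ _ _ (by omega), e, Nat.add_sub_cancel_left,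
    List.getD_append]
  rw [hw]
  simp only [List.length_cons, List.length_replicate]
  omega

/-- The sequence is its own image under the substitution `1 ↦ 112`, `2 ↦ 11222`, its terms from
index five on being the images of those from index two on. -/
structure IsSelfSimilar (a s : ℕ → ℕ) : Prop where
  start : s 0 = 5
  one_or_two : ∀ j, a (j + 2) = 1 ∨ a (j + 2) = 2
  succ : ∀ j, s (j + 1) = s j + 2 + (2 * a (j + 2) - 1)
  first : ∀ j, a (s j) = 1
  second : ∀ j, a (s j + 1) = 1
  rest : ∀ j, ∀ i < 2 * a (j + 2) - 1, a (s j + 2 + i) = 2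

theorem isSelfSimilar_blockStart {a : ℕ → ℕ}
    (ha : ∀ j M, j + 1 ≤ M → a (j + 2) = (totalWord M).getD j 0) :
    IsSelfSimilar a (blockStart a) where
  start := rfl
  one_or_two := eq_one_or_two ha
  succ _ := rfl
  first j := block_eq ha j 0 (by omega)
  second j := block_eq ha j 1 (by omega)
  rest j i hi := by
    rw [add_assoc, block_eq ha j (2 + i) (by omega), add_comm 2 i]
    simp [hi]

namespace IsSelfSimilar

variable {a s : ℕ → ℕ} (h : IsSelfSimilar a s)

include h

theorem isDiamondPattern : IsDiamondPattern a 5 := by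
  refine ⟨s, fun j => 2 * a (j + 2) - 1, h.start, fun j => ⟨?_, h.succ j, h.first j, h.second j,
    h.rest j⟩⟩
  have := h.one_or_two j
  grind

theorem add_le (j d : ℕ) : s j + 3 * d ≤ s (j + d) := by
  induction d with
  | zero => simp
  | succ d ih =>
    have h1 := h.succ (j + d)
    have h2 := h.one_or_two (j + d)
    rw [← add_assoc]
    omega

/-- In a block the second 1 is followed by a 2 and all later entries are 2, so two consecutive ones
mark a block start. -/
theorem exists_start_eq {n : ℕ} (hn : 5 ≤ n) (h1 : a n = 1) (h2 : a (n + 1) = 1) :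
    ∃ j, s j = n := by
  have hex : ∃ j, n < s (j + 1) := ⟨n, by
    have := h.add_le 0 (n + 1)
    rw [zero_add] at this
    omega⟩
  obtain ⟨j, hj, hmin⟩ : ∃ j, n < s (j + 1) ∧ s j ≤ n := by
    refine ⟨Nat.find hex, Nat.find_spec hex, ?_⟩
    rcases hk : Nat.find hex with _ | k
    · rw [h.start]
      exact hn
    · exact not_lt.1 (Nat.find_min hex (show k < _ by omega))
  refine ⟨j, ?_⟩
  have hs := h.succ j
  have ho := h.one_or_two j
  by_contra hne
  by_cases hn1 : n = s j + 1
  · have := h.rest j 0 (by omega)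
    rw [hn1] at h2
    rw [add_zero, show s j + 2 = s j + 1 + 1 by omega] at this
    omega
  · have := h.rest j (n - s j - 2) (by omega)
    rw [show s j + 2 + (n - s j - 2) = n by omega] at this
    omega

/-- The entry at offset 3 recovers the letter whose image the block is: after 112 it is the first 1
of the next block, in 11222 it is still a 2. -/
theorem third_rest (j : ℕ) : a (s j + 3) = a (j + 2) := by
  rcases h.one_or_two j with h1 | h1
  · have := h.first (j + 1)
    rw [h.succ, h1] at this
    rw [h1, ← this]
  · have := h.rest j 1 (by omega)
    rw [h1, ← this]

/-- Descent on the period. Translation by p preserves pairs 1, 1, hence sends block starts to block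
starts, shifting the block index by a constant q. Since `third_rest` reads the letters off the
blocks, q is again an eventual period, and blocks of length at least 3 force q < p. -/
theorem not_eventuallyPeriodic : ¬ EventuallyPeriodic a := by
  suffices H : ∀ p N, 1 ≤ p → ¬ ∀ n, N ≤ n → a (n + p) = a n by
    rintro ⟨p, N, hp, hN⟩
    exact H p N hp hN
  intro p
  induction p using Nat.strong_induction_on with
  | _ p ih =>
    intro N hp hN
    have hs0 : ∀ j, j + 5 ≤ s j := fun j => by
      have := h.add_le 0 j
      rw [zero_add, h.start] at this
      omega
    obtain ⟨i, hi⟩ := h.exists_start_eq (n := s N + p) (by have := hs0 N; omega)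
      (by rw [hN _ (by have := hs0 N; omega), h.first])
      (by rw [show s N + p + 1 = s N + 1 + p by omega, hN _ (by have := hs0 N; omega), h.second])
    have hNi : N < i := by
      by_contra hle
      have := h.add_le i (N - i)
      rw [show i + (N - i) = N by omega] at this
      omega
    obtain ⟨q, rfl⟩ : ∃ q, i = N + q := ⟨i - N, by omega⟩
    have hq := h.add_le N q
    have third : ∀ d, s (N + d + q) = s (N + d) + p → a (N + d + q + 2) = a (N + d + 2) := by
      intro d hd
      rw [← h.third_rest, ← h.third_rest (N + d), hd,
        show s (N + d) + p + 3 = s (N + d) + 3 + p by omega]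
      exact hN _ (by have := hs0 (N + d); omega)
    have shift : ∀ d, s (N + d + q) = s (N + d) + p := by
      intro d
      induction d with
      | zero => exact hi
      | succ d ihd =>
        have h1 := third d ihd
        have h2 := h.succ (N + d + q)
        have h3 := h.succ (N + d)
        rw [show N + (d + 1) + q = N + d + q + 1 by omega, h2, h1, ihd, ← add_assoc, h3]
        omega
    refine ih q (by omega) (N + 2) (by omega) fun n hn => ?_
    have := third (n - N - 2) (shift _)
    rwa [show N + (n - N - 2) + q + 2 = n + q by omega,
      show N + (n - N - 2) + 2 = n by omega] at this

end IsSelfSimilar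

end Pattern

/-! ### Dimensions, width and failure of thinness -/

section Dimensions

variable (K : Type*) [Field K] [CharP K 2]

theorem length_le_bitWeight : ∀ (l : List Bool) (i : ℕ), l.length ≤ bitWeight i l
  | [], _ => le_rfl
  | true :: l, i => by
      have h1 := length_le_bitWeight l (i + 1)
      have h2 := pivotWeight_pos i
      rw [bitWeight, List.length_cons]
      omega
  | false :: l, i => by
      have h1 := length_le_bitWeight l (i + 1)
      have h2 := pivotWeight_pos i
      rw [bitWeight, List.length_cons]
      omega

theorem rank_RComponent_one : Module.rank K (RComponent K 1) = 2 := by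
  refine ((isStandardBasis_basisR K).rank_degreeComponent {none, some []} fun i => ?_).trans ?_
  · simp [basisWeight_eq_one_iff]
  · simp

theorem rank_RComponent_add_two (j M : ℕ) (h : j + 1 ≤ M) :
    Module.rank K (RComponent K (j + 2)) = ((totalWord M).getD j 0 : ℕ) := by
  set s := (Finset.range (M + 1)).biUnion fun m => (bitLists m).filter fun l => bitWeight 0 l = j + 1
  have hs : s.card = (totalWord M).getD j 0 := by
    rw [← sum_bitCount]
    refine Finset.card_biUnion fun m _ m' _ hm => Finset.disjoint_left.2 fun l hl hl' => hm ?_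
    rw [← (mem_bitLists m l).1 (Finset.mem_filter.1 hl).1,
      ← (mem_bitLists m' l).1 (Finset.mem_filter.1 hl').1]
  refine ((isStandardBasis_basisR K).rank_degreeComponent (s.map .some) fun i => ?_).trans
    (by rw [Finset.card_map, hs])
  cases i with
  | none => simp [basisWeight]
  | some l =>
    -- Each position weighs at least 1, so lists of weight j + 1 have length at most j + 1 ≤ M, and
    -- the bound M loses none.
    have := length_le_bitWeight l 0
    simp only [s, Finset.mem_map, Finset.mem_biUnion, Finset.mem_filter, mem_bitLists,
      Finset.mem_range, Function.Embedding.some_apply, Option.some.injEq, exists_eq_right,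
      basisWeight]
    constructor
    · rintro ⟨m, -, -, hl⟩
      omega
    · exact fun hl => ⟨l.length, by omega, rfl, by omega⟩

theorem isSelfSimilar_finrank : IsSelfSimilar (fun n => Module.finrank K (RComponent K n))
    (blockStart fun n => Module.finrank K (RComponent K n)) :=
  isSelfSimilar_blockStart fun j M h => by
    rw [Module.finrank, rank_RComponent_add_two K j M h, Cardinal.toNat_natCast]

theorem hasWidth_RComponent : HasWidth (RComponent K) 2 := by
  refine ⟨fun n hn => ?_, fun e he => ?_⟩
  · obtain _ | _ | j := n
    · omega
    · rw [zero_add, rank_RComponent_one]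
      exact le_rfl
    · have h := (isSelfSimilar_finrank K).one_or_two j
      have hr := rank_RComponent_add_two K j (j + 1) le_rfl
      simp only [Module.finrank, hr, Cardinal.toNat_natCast] at h
      rw [hr, Nat.cast_le]
      omega
  · have := he 1 le_rfl
    rw [rank_RComponent_one] at this
    exact_mod_cast this

attribute [local instance 100] LieRing.ofAssociativeRing in
theorem not_isThin_RComponent : ¬ IsThin (RComponent K) := by
  intro hthin
  have hb := isStandardBasis_basisR K
  -- The list `[false]` encodes v_2, `[true, false]` encodes x_0 v_3, and `[false, true]` encodes
  -- x_1 v_3.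
  have hz : basisR K (some [false]) ∈ RComponent K 3 :=
    hb.basis_mem_degreeComponent 3 _ rfl
  have hw : basisR K (some [true, false]) ∈ (RComponent K (3 + 1) : Set (R K)) :=
    hb.basis_mem_degreeComponent 4 _ rfl
  rw [hthin.covering 3 (by omega) _ hz ((basisR K).ne_zero _)] at hw
  obtain ⟨y, hy, hyw⟩ := hw
  have hy' : y ∈ IsStandardBasis.weightSpan (basisR K) basisWeight {1} := by
    rwa [← hb.degreeComponent_eq]
  have hmem : ⁅y, basisR K (some [false])⁆ ∈
      Submodule.span K (basisR K '' {some [false, true]}) := by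
    refine IsStandardBasis.mem_of_basis_lie (fun i hi => ?_) hy'
    rcases (basisWeight_eq_one_iff i).1 hi with rfl | rfl
    · have h0 : ⁅basisR K none, basisR K (some [false])⁆ = 0 := by
        refine Subtype.ext ?_
        rw [LieSubalgebra.coe_bracket, coe_basisR, coe_basisR]
        exact lie_pivot_zero_basisElt K (some [false])
      rw [h0]
      exact Submodule.zero_mem _
    · refine Submodule.subset_span ⟨_, rfl, Subtype.ext ?_⟩
      rw [LieSubalgebra.coe_bracket, coe_basisR, coe_basisR, coe_basisR]
      exact (lie_pivot_one_basisElt K (some [false])).symm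
  rw [hyw] at hmem
  exact (basisR K).linearIndependent.notMem_span_image (by simp) hmem

end Dimensions

end FractalLie

theorem corollary9p2 (K : Type*) [Field K] [CharP K 2] :
    FractalLie.IsLieGrading (FractalLie.RComponent K) ∧
    (∀ n : ℕ, 1 ≤ n →
      Module.rank K (FractalLie.RComponent K n) =
        Module.rank K (FractalLie.LowerCentralFactor K (FractalLie.R K) n)) ∧
    FractalLie.IsDiamondPattern (fun n => Module.finrank K (FractalLie.RComponent K n)) 5 ∧
    ¬ FractalLie.EventuallyPeriodic (fun n => Module.finrank K (FractalLie.RComponent K n)) ∧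
    FractalLie.HasWidth (FractalLie.RComponent K) 2 ∧
    ¬ FractalLie.IsThin (FractalLie.RComponent K) := by
  refine ⟨(FractalLie.isStandardBasis_basisR K).isLieGrading,
    fun n hn => (FractalLie.isStandardBasis_basisR K).rank_lowerCentralFactor hn,
    (FractalLie.isSelfSimilar_finrank K).isDiamondPattern,
    (FractalLie.isSelfSimilar_finrank K).not_eventuallyPeriodic,
    FractalLie.hasWidth_RComponent K, FractalLie.not_isThin_RComponent K⟩
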